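/- A pair $(X,Y)$ of random variables on a probability space $(\Omega,\mathcal F,\mathbb P)$ is called coherent if there are an event $A\in\mathcal F$ and sub-$\sigma$-fields $\mathcal G,\mathcal H\subset\mathcal F$ with $X=\mathbb P(A\mid\mathcal G)$ and $Y=\mathbb P(A\mid\mathcal H)$ almost surely. Let $\mathcal C_{\mathcal I}$ be the family of all coherent pairs $(X,Y)$, on all probability spaces, for which $X$ and $Y$ are independent. Let $\mathrm{STEP}$ be the set of weakly decreasing functions $f:[0,1]\to[0,1]$ that take only finitely many values. For $f\in\mathrm{STEP}$ let $F_f=\{(u,v)\in[0,1]^2: v<f(u)\}$, let $\mathrm{bd}(F_f)$ be its boundary in $[0,1]^2$, and define two random variables on the square $[0,1]^2$ with Lebesgue measure $\lambda\otimes\lambda$ by $$X_f(u,v)=\lambda\big(\{v'\in[0,1]:(u,v')\in F_f\setminus \mathrm{bd}(F_f)\}\big),\qquad Y_f(u,v)=\lambda\big(\{u'\in[0,1]:(u',v)\in F_f\setminus \mathrm{bd}(F_f)\}\big).$$ Then for every integer $k\ge 3$, $$\sup_{f\in\mathrm{STEP}}\mathbb E|X_f-Y_f|^k=\sup_{(X,Y)\in\mathcal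 C_{\mathcal I}}\mathbb E|X-Y|^k,$$ both suprema being finite. -/

import Mathlib

open MeasureTheory ProbabilityTheory

universe u

/-- The pair `(X, Y)` of random variables on `(Ω, m, μ)` is coherent: for some event `A` and some
sub-σ-fields `𝒢, ℋ` of `m`, `X` is a version of `ℙ(A | 𝒢)` and `Y` is a version of `ℙ(A | ℋ)`. -/
def IsCoherent {Ω : Type u} {m : MeasurableSpace Ω} (X Y : Ω → ℝ) (μ : Measure Ω) : Prop :=
  Measurable X ∧ Measurable Y ∧
    ∃ (A : Set Ω) (𝒢 ℋ : MeasurableSpace Ω), MeasurableSet[m] A ∧ 𝒢 ≤ m ∧ ℋ ≤ m ∧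
      X =ᵐ[μ] μ[A.indicator (fun _ => (1 : ℝ)) | 𝒢] ∧
      Y =ᵐ[μ] μ[A.indicator (fun _ => (1 : ℝ)) | ℋ]

/-- The pair `(X, Y)` is coherent and, in addition, `X` and `Y` are independent. -/
def IsIndepCoherent {Ω : Type u} {m : MeasurableSpace Ω} (X Y : Ω → ℝ) (μ : Measure Ω) : Prop :=
  IsCoherent X Y μ ∧ IndepFun X Y μ

/-- Weakly decreasing step functions `[0,1] → [0,1]` with finitely many values. -/
def STEP : Set (unitInterval → unitInterval) :=
  {f | Antitone f ∧ (Set.range f).Finite}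

/-- The generalised Ferrer diagram `F_f = {(u, v) ∈ [0,1]² : v < f u}`. -/
def ferrerDiagram (f : unitInterval → unitInterval) : Set (unitInterval × unitInterval) :=
  {p | p.2 < f p.1}

/-- `X_f (u, v)` is the Lebesgue measure of the section of `F_f \ bd F_f` over the abscissa `u`. -/
noncomputable def ferrerX (f : unitInterval → unitInterval) (p : unitInterval × unitInterval) :
    ℝ :=
  volume.real {v : unitInterval | (p.1, v) ∈ ferrerDiagram f \ frontier (ferrerDiagram f)}

/-- `Y_f (u, v)` is the Lebesgue measure of the section of `F_f \ bd F_f` at the height `v`. -/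
noncomputable def ferrerY (f : unitInterval → unitInterval) (p : unitInterval × unitInterval) :
    ℝ :=
  volume.real {u : unitInterval | (u, p.2) ∈ ferrerDiagram f \ frontier (ferrerDiagram f)}

/-- The numbers `𝔼|X_f - Y_f|^k`, `f ∈ STEP`, the expectation being with respect to the Lebesgue
measure `λ ⊗ λ` on the unit square. -/
def stepMoments (k : ℕ) : Set ℝ :=
  {r | ∃ f ∈ STEP, r = ∫ p : unitInterval × unitInterval, |ferrerX f p - ferrerY f p| ^ k}

/-- The numbers `𝔼|X - Y|^k` for all independent coherent pairs `(X, Y)` on all probability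
spaces. -/
def indepCoherentMoments (k : ℕ) : Set ℝ :=
  {r | ∃ (Ω : Type u) (_ : MeasurableSpace Ω) (μ : Measure Ω) (_ : IsProbabilityMeasure μ)
    (X Y : Ω → ℝ), IsIndepCoherent X Y μ ∧ r = ∫ ω, |X ω - Y ω| ^ k ∂μ}

/-! Write `k = j + 3`. The interior of a Ferrer diagram is an event in the square, and its section
lengths are its conditional probabilities given the two independent coordinates. Hence every step
moment is the moment of an independent coherent pair, and only the reverse inequality needs an
argument.

Let `(X, Y)` be independent and coherent for the event `A`. For `s = ℙ(Y > t)`, independence gives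
`ℙ(A, Y > t) ≤ ℙ(A, X ≤ s) + ℙ(X > s) s = 𝔼 min(X, s)`. If `Z ≥ X` has conjugate `G(v) = ℙ(Z > v)`,
the layer cake formula turns this into `𝔼(Y - t)⁺ ≤ ∫_{v<s} (G(v) - t) dv ≤ ∫ (G - t)⁺`
(`integral_hinge_le_conjugate`). So `G` dominates `Y` on all hinge functions.

For fixed `x`, Taylor's formula writes `|x - y| ^ k` as an affine function of `y` plus a positive
mixture of hinges. The linear coefficient is negative, so the means must also be compared: `∫ G =
𝔼Z`, while `𝔼X = 𝔼Y = ℙ(A)`, so the excess is at most the error `ε` in `X ≤ Z ≤ X + ε`. Conditioning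
on `Z`, which is independent of `Y`, replaces `Y` by an independent copy of `G` at a cost of order
`ε` (`integral_abs_sub_pow_le_conjugate`).

With `Z` the rounding of `X` up to multiples of `1 / n`, a step function `f` with `v < f u ↔ u < G
v` has the law of `Z` and conjugate `G`, so the bound is itself a step moment
(`conjugate_moment_mem_stepMoments`). Let `n → ∞`. -/

/-! ### Powers as mixtures of hinge functions -/

theorem hasDerivAt_taylorPrimitive (j : ℕ) (x y : ℝ) {t : ℝ} (ht : t ≠ x) :
    HasDerivAt (fun t => |x - t| ^ (j + 3) - (j + 3) * ((x - t) * |x - t| ^ (j + 1)) * (y - t))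
      ((j + 3) * (j + 2) * (|x - t| ^ (j + 1) * (y - t))) t := by
  have h1 : HasDerivAt (fun t : ℝ => x - t) (-1) t := by
    simpa using (hasDerivAt_id t).const_sub x
  have h2 : HasDerivAt (fun t : ℝ => y - t) (-1) t := by
    simpa using (hasDerivAt_id t).const_sub y
  rcases lt_or_gt_of_ne ht with h | h
  · have ha : HasDerivAt (fun t : ℝ => |x - t|) (-1) t :=
      ((hasDerivAt_abs_pos (sub_pos.2 h)).comp t h1).congr_deriv (by simp)
    have h3 := (ha.pow (j + 3)).sub
      (((h1.mul (ha.pow (j + 1))).const_mul ((j : ℝ) + 3)).mul h2)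
    refine h3.congr_deriv ?_
    have hx : |x - t| = x - t := abs_of_pos (sub_pos.2 h)
    simp only [Pi.pow_apply, Pi.mul_apply, hx]
    push_cast
    ring
  · have ha : HasDerivAt (fun t : ℝ => |x - t|) 1 t :=
      ((hasDerivAt_abs_neg (sub_neg.2 h)).comp t h1).congr_deriv (by simp)
    have h3 := (ha.pow (j + 3)).sub
      (((h1.mul (ha.pow (j + 1))).const_mul ((j : ℝ) + 3)).mul h2)
    refine h3.congr_deriv ?_
    have hx : |x - t| = t - x := by rw [abs_of_neg (sub_neg.2 h)]; ring
    simp only [Pi.pow_apply, Pi.mul_apply, hx]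
    push_cast
    ring

/-- Taylor's formula with integral remainder for `y ↦ |x - y| ^ (j + 3)`, as a mixture of
hinge functions. -/
theorem abs_sub_pow_eq_integral_hinge (j : ℕ) {x y : ℝ} (hx : 0 ≤ x) (hy : 0 ≤ y) (hy1 : y ≤ 1) :
    |x - y| ^ (j + 3) = x ^ (j + 3) - (j + 3) * x ^ (j + 2) * y +
      (j + 3) * (j + 2) * ∫ t in (0 : ℝ)..1, |x - t| ^ (j + 1) * max (y - t) 0 := by
  have hc : Continuous fun t : ℝ => |x - t| ^ (j + 1) * max (y - t) 0 := by fun_prop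
  have h1 : ∫ t in (0 : ℝ)..1, |x - t| ^ (j + 1) * max (y - t) 0 =
      ∫ t in (0 : ℝ)..y, |x - t| ^ (j + 1) * (y - t) := by
    rw [← intervalIntegral.integral_add_adjacent_intervals (hc.intervalIntegrable 0 y)
      (hc.intervalIntegrable y 1)]
    have h2 : ∫ t in y..1, |x - t| ^ (j + 1) * max (y - t) 0 = 0 := by
      rw [intervalIntegral.integral_congr (g := fun _ => (0 : ℝ))]
      · simp
      · intro t ht
        rw [Set.uIcc_of_le hy1] at ht
        simp [max_eq_right (sub_nonpos.2 ht.1)]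
    rw [h2, add_zero]
    refine intervalIntegral.integral_congr fun t ht => ?_
    rw [Set.uIcc_of_le hy] at ht
    simp [max_eq_left (sub_nonneg.2 ht.2)]
  -- The primitive is `|x - y| ^ (j + 3)` at `t = y`, and minus the affine part at `t = 0`. The
  -- point `t = x`, where the absolute value has its kink, is a countable exception.
  have h3 := integral_eq_of_hasDerivAt_off_countable
    (fun t => |x - t| ^ (j + 3) - (j + 3) * ((x - t) * |x - t| ^ (j + 1)) * (y - t))
    (fun t => (j + 3) * (j + 2) * (|x - t| ^ (j + 1) * (y - t))) (a := 0) (b := y)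
    (Set.countable_singleton x) (by fun_prop)
    (fun t ht => hasDerivAt_taylorPrimitive j x y ht.2)
    (Continuous.intervalIntegrable (by fun_prop) _ _)
  rw [h1, ← intervalIntegral.integral_const_mul, h3]
  simp only [sub_zero, sub_self, abs_of_nonneg hx]
  ring

theorem integrable_of_abs_le {Ω : Type*} {m : MeasurableSpace Ω} {μ : Measure Ω}
    [IsFiniteMeasure μ] {f : Ω → ℝ} (hf : Measurable f) (C : ℝ) (h : ∀ ω, |f ω| ≤ C) :
    Integrable f μ :=
  Integrable.of_bound hf.aestronglyMeasurable C (Filter.Eventually.of_forall h)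

theorem integral_abs_sub_pow_eq {Ω : Type*} {m : MeasurableSpace Ω} {μ : Measure Ω}
    [IsProbabilityMeasure μ] {Y : Ω → ℝ} (hY : Measurable Y) (hY01 : ∀ ω, Y ω ∈ Set.Icc 0 1)
    (j : ℕ) {x : ℝ} (hx : x ∈ Set.Icc (0 : ℝ) 1) :
    ∫ ω, |x - Y ω| ^ (j + 3) ∂μ = x ^ (j + 3) - (j + 3) * x ^ (j + 2) * ∫ ω, Y ω ∂μ +
      (j + 3) * (j + 2) *
        ∫ t in (0 : ℝ)..1, |x - t| ^ (j + 1) * ∫ ω, max (Y ω - t) 0 ∂μ := by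
  have hint : Integrable Y μ := integrable_of_abs_le hY 1 fun ω => by
    rw [abs_of_nonneg (hY01 ω).1]; exact (hY01 ω).2
  have hprod : Integrable (Function.uncurry fun (ω : Ω) (t : ℝ) =>
      |x - t| ^ (j + 1) * max (Y ω - t) 0) (μ.prod (volume.restrict (Set.Ioc 0 1))) := by
    refine Integrable.of_bound (C := 1) (Measurable.aestronglyMeasurable (by fun_prop)) ?_
    have h0 : ∀ᵐ p : Ω × ℝ ∂(μ.prod (volume.restrict (Set.Ioc (0 : ℝ) 1))),
        p.2 ∈ Set.Ioc (0 : ℝ) 1 :=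
      Measure.quasiMeasurePreserving_snd.ae (ae_restrict_mem measurableSet_Ioc)
    filter_upwards [h0] with p hp
    have hY := hY01 p.1
    have e1 : |x - p.2| ≤ 1 := abs_le.2 ⟨by linarith [hx.1, hp.2], by linarith [hx.2, hp.1]⟩
    have e2 : max (Y p.1 - p.2) 0 ≤ 1 := max_le (by linarith [hY.2, hp.1]) zero_le_one
    simp only [Function.uncurry, Real.norm_eq_abs]
    rw [abs_mul, abs_of_nonneg (le_max_right (Y p.1 - p.2) 0), abs_of_nonneg (by positivity)]
    exact mul_le_one₀ (pow_le_one₀ (abs_nonneg _) e1) (le_max_right _ _) e2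
  have hswap := integral_integral_swap hprod
  simp only [intervalIntegral.integral_of_le zero_le_one]
  have h1 : ∀ ω, |x - Y ω| ^ (j + 3) = x ^ (j + 3) - (j + 3) * x ^ (j + 2) * Y ω +
      (j + 3) * (j + 2) * ∫ t in Set.Ioc (0 : ℝ) 1, |x - t| ^ (j + 1) * max (Y ω - t) 0 :=
    fun ω => by
      rw [abs_sub_pow_eq_integral_hinge j hx.1 (hY01 ω).1 (hY01 ω).2,
        intervalIntegral.integral_of_le zero_le_one]
  simp only [h1]
  rw [integral_add, integral_sub, integral_const_mul, integral_const_mul, hswap]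
  · simp [integral_const_mul]
  · exact integrable_const _
  · exact hint.const_mul _
  · exact (integrable_const _).sub (hint.const_mul _)
  · exact (hprod.integral_prod_left).const_mul _

theorem continuous_integral_hinge {Ω : Type*} {m : MeasurableSpace Ω} {μ : Measure Ω}
    [IsProbabilityMeasure μ] {Y : Ω → ℝ} (hY : Measurable Y) (hY01 : ∀ ω, Y ω ∈ Set.Icc 0 1) :
    Continuous fun t => ∫ ω, max (Y ω - t) 0 ∂μ := by
  refine continuous_iff_continuousAt.2 fun t₀ => ?_
  refine continuousAt_of_dominated (bound := fun _ => 2 + |t₀|)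
    (Filter.Eventually.of_forall fun t => Measurable.aestronglyMeasurable (by fun_prop)) ?_
    (integrable_const _) (Filter.Eventually.of_forall fun ω => by fun_prop)
  filter_upwards [Metric.ball_mem_nhds t₀ one_pos] with t ht
  refine Filter.Eventually.of_forall fun ω => ?_
  rw [Metric.mem_ball, Real.dist_eq, abs_lt] at ht
  rw [Real.norm_eq_abs, abs_of_nonneg (le_max_right _ _)]
  exact max_le (by linarith [(hY01 ω).2, neg_abs_le t₀]) (by positivity)

/-- Comparison of expectations of hinge functions yields comparison of `𝔼|x - ·| ^ (j + 3)`. -/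
theorem integral_abs_sub_pow_le_of_hinge {Ω Ω' : Type*} {m : MeasurableSpace Ω}
    {m' : MeasurableSpace Ω'} {μ : Measure Ω} [IsProbabilityMeasure μ] {ν : Measure Ω'}
    [IsProbabilityMeasure ν] {Y : Ω → ℝ} {W : Ω' → ℝ} (hY : Measurable Y) (hW : Measurable W)
    (hY01 : ∀ ω, Y ω ∈ Set.Icc 0 1) (hW01 : ∀ ω, W ω ∈ Set.Icc 0 1) (j : ℕ) {ε x : ℝ}
    (hx : x ∈ Set.Icc (0 : ℝ) 1) (hε : 0 ≤ ε) (hmean : ∫ ω, W ω ∂ν ≤ ∫ ω, Y ω ∂μ + ε)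
    (hinge : ∀ t ∈ Set.Icc (0 : ℝ) 1, ∫ ω, max (Y ω - t) 0 ∂μ ≤ ∫ ω, max (W ω - t) 0 ∂ν) :
    ∫ ω, |x - Y ω| ^ (j + 3) ∂μ ≤ ∫ ω, |x - W ω| ^ (j + 3) ∂ν + (j + 3) * ε := by
  rw [integral_abs_sub_pow_eq hY hY01 j hx, integral_abs_sub_pow_eq hW hW01 j hx]
  have h1 : ∫ t in (0 : ℝ)..1, |x - t| ^ (j + 1) * ∫ ω, max (Y ω - t) 0 ∂μ ≤
      ∫ t in (0 : ℝ)..1, |x - t| ^ (j + 1) * ∫ ω, max (W ω - t) 0 ∂ν := by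
    have k1 := continuous_integral_hinge (μ := μ) hY hY01
    have k2 := continuous_integral_hinge (μ := ν) hW hW01
    refine intervalIntegral.integral_mono_on zero_le_one
      (Continuous.intervalIntegrable (by fun_prop) _ _)
      (Continuous.intervalIntegrable (by fun_prop) _ _) fun t ht => ?_
    exact mul_le_mul_of_nonneg_left (hinge t ht) (by positivity)
  -- The linear term enters with a negative sign, so a larger mean of `W` works against the claim;
  -- this bounds the loss.
  have h2 : x ^ (j + 2) * (∫ ω, W ω ∂ν - ∫ ω, Y ω ∂μ) ≤ ε := by
    have hp0 : 0 ≤ x ^ (j + 2) := pow_nonneg hx.1 _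
    have hp1 : x ^ (j + 2) ≤ 1 := pow_le_one₀ hx.1 hx.2
    nlinarith
  have h3 : ((j : ℝ) + 3) * (x ^ (j + 2) * (∫ ω, W ω ∂ν - ∫ ω, Y ω ∂μ)) ≤ (j + 3) * ε :=
    mul_le_mul_of_nonneg_left h2 (by positivity)
  have h4 := mul_le_mul_of_nonneg_left h1 (show (0 : ℝ) ≤ (j + 3) * (j + 2) by positivity)
  linarith

/-! ### Coherence, independence and the hinge bound -/

/-- The event `X ∈ S` need not lie in `𝒢`, but it agrees up to a null set with the same event for
the `𝒢`-measurable version, where the defining property of conditional expectation applies. -/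
theorem setIntegral_preimage_of_ae_eq_condExp {Ω : Type*} {𝒢 m : MeasurableSpace Ω}
    {μ : Measure Ω} [IsProbabilityMeasure μ] {A : Set Ω} (hA : MeasurableSet A) (h𝒢 : 𝒢 ≤ m)
    {X : Ω → ℝ} (h : X =ᵐ[μ] μ[A.indicator (fun _ => (1 : ℝ)) | 𝒢])
    {S : Set ℝ} (hS : MeasurableSet S) :
    ∫ ω in X ⁻¹' S, X ω ∂μ = μ.real (A ∩ X ⁻¹' S) := by
  set X₀ : Ω → ℝ := μ[A.indicator (fun _ => (1 : ℝ)) | 𝒢] with hX₀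
  have hset : X ⁻¹' S =ᵐ[μ] X₀ ⁻¹' S := h.preimage S
  have hS₀ : MeasurableSet[𝒢] (X₀ ⁻¹' S) := stronglyMeasurable_condExp.measurable hS
  rw [setIntegral_congr_set hset, setIntegral_congr_ae (h𝒢 _ hS₀) (h.mono fun ω hω _ => hω),
    setIntegral_condExp h𝒢 ((integrable_const _).indicator hA) hS₀, integral_indicator hA,
    Measure.restrict_restrict hA, setIntegral_const, smul_eq_mul, mul_one]
  exact measureReal_congr ((ae_eq_refl A).inter hset.symm)

theorem integral_of_ae_eq_condExp {Ω : Type*} {𝒢 m : MeasurableSpace Ω}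
    {μ : Measure Ω} [IsProbabilityMeasure μ] {A : Set Ω} (hA : MeasurableSet A) (h𝒢 : 𝒢 ≤ m)
    {X : Ω → ℝ} (h : X =ᵐ[μ] μ[A.indicator (fun _ => (1 : ℝ)) | 𝒢]) :
    ∫ ω, X ω ∂μ = μ.real A := by
  simpa using setIntegral_preimage_of_ae_eq_condExp hA h𝒢 h MeasurableSet.univ

/-- The key inequality: with `s = ℙ(Y > t)`, one has `𝔼(Y - t)⁺ ≤ 𝔼 min(X, s) - t s`. -/
theorem integral_hinge_le_integral_min {Ω : Type*} {𝒢 ℋ m : MeasurableSpace Ω}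
    {μ : Measure Ω} [IsProbabilityMeasure μ] {A : Set Ω} (hA : MeasurableSet A) (h𝒢 : 𝒢 ≤ m)
    (hℋ : ℋ ≤ m) {X Y : Ω → ℝ} (hX : Measurable X) (hY : Measurable Y)
    (hX01 : ∀ ω, X ω ∈ Set.Icc 0 1) (hY01 : ∀ ω, Y ω ∈ Set.Icc 0 1)
    (h : X =ᵐ[μ] μ[A.indicator (fun _ => (1 : ℝ)) | 𝒢])
    (h' : Y =ᵐ[μ] μ[A.indicator (fun _ => (1 : ℝ)) | ℋ]) (hXY : IndepFun X Y μ) (t : ℝ) :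
    ∫ ω, max (Y ω - t) 0 ∂μ ≤
      ∫ ω, min (X ω) (μ.real (Y ⁻¹' Set.Ioi t)) ∂μ - t * μ.real (Y ⁻¹' Set.Ioi t) := by
  set B := Y ⁻¹' Set.Ioi t with hB
  set s := μ.real B with hs
  have hBm : MeasurableSet B := hY measurableSet_Ioi
  have hXi : Integrable X μ := integrable_of_abs_le hX 1 fun ω => by
    rw [abs_of_nonneg (hX01 ω).1]; exact (hX01 ω).2
  have hYi : Integrable Y μ := integrable_of_abs_le hY 1 fun ω => by
    rw [abs_of_nonneg (hY01 ω).1]; exact (hY01 ω).2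
  have h1 : ∫ ω, max (Y ω - t) 0 ∂μ = μ.real (A ∩ B) - t * s := by
    have : (fun ω => max (Y ω - t) 0) = B.indicator fun ω => Y ω - t := by
      funext ω
      by_cases hω : t < Y ω
      · rw [Set.indicator_of_mem (by exact hω), max_eq_left (sub_nonneg.2 hω.le)]
      · rw [Set.indicator_of_notMem (by exact hω), max_eq_right (sub_nonpos.2 (not_lt.1 hω))]
    rw [this, integral_indicator hBm, integral_sub hYi.integrableOn (integrable_const _),
      setIntegral_preimage_of_ae_eq_condExp hA hℋ h' measurableSet_Ioi]
    simp [hs, mul_comm]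
    rfl
  have hCm : MeasurableSet (X ⁻¹' Set.Iic s) := hX measurableSet_Iic
  have h2 : ∫ ω, min (X ω) s ∂μ =
      μ.real (A ∩ X ⁻¹' Set.Iic s) + μ.real (X ⁻¹' Set.Ioi s) * s := by
    have hi : Integrable (fun ω => min (X ω) s) μ := hXi.inf (integrable_const s)
    rw [← integral_add_compl hCm hi,
      ← setIntegral_preimage_of_ae_eq_condExp hA h𝒢 h measurableSet_Iic]
    congr 1
    · exact setIntegral_congr_fun hCm fun ω hω => min_eq_left hω
    · have hc : (X ⁻¹' Set.Iic s)ᶜ = X ⁻¹' Set.Ioi s := by ext ω; simp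
      rw [hc, setIntegral_congr_fun (g := fun _ => s) (hX measurableSet_Ioi)
        fun ω hω => min_eq_right (le_of_lt hω)]
      simp
  -- Keep `A` where `X ≤ s` and `B` where `X > s`. By independence the second piece has mass `ℙ(X >
  -- s) s`, so cutting at the level `s = ℙ(B)` makes the sum exactly `𝔼 min(X, s)`.
  have h3 : μ.real (A ∩ B) ≤ μ.real (A ∩ X ⁻¹' Set.Iic s) + μ.real (X ⁻¹' Set.Ioi s ∩ B) := by
    refine le_trans (measureReal_mono ?_) (measureReal_union_le _ _)
    rintro ω ⟨ha, hb⟩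
    rcases le_or_gt (X ω) s with hω | hω
    · exact Or.inl ⟨ha, hω⟩
    · exact Or.inr ⟨hω, hb⟩
  have h4 : μ.real (X ⁻¹' Set.Ioi s ∩ B) = μ.real (X ⁻¹' Set.Ioi s) * s := by
    simp only [hs, measureReal_def, hB, ← ENNReal.toReal_mul]
    rw [hXY.measure_inter_preimage_eq_mul _ _ measurableSet_Ioi measurableSet_Ioi]
  rw [h1, h2]
  linarith

/-! ### Distributional conjugates -/

/-- Layer cake formula for random variables with values in the unit interval. -/
theorem setIntegral_measureReal_gt {Ω : Type*} {m : MeasurableSpace Ω} {μ : Measure Ω}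
    [IsProbabilityMeasure μ] {Z : Ω → unitInterval} (hZ : Measurable Z) (S : Set unitInterval) :
    ∫ v in S, μ.real {ω | v < Z ω} = ∫ ω, volume.real (S ∩ Set.Iio (Z ω)) ∂μ := by
  have hD : MeasurableSet {p : unitInterval × Ω | p.1 < Z p.2} :=
    measurableSet_lt measurable_fst (hZ.comp measurable_snd)
  have hi : Integrable (Function.uncurry fun (v : unitInterval) (ω : Ω) =>
      {p : unitInterval × Ω | p.1 < Z p.2}.indicator (fun _ => (1 : ℝ)) (v, ω))
      ((volume.restrict S).prod μ) := (integrable_const (1 : ℝ)).indicator hD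
  have hswap := integral_integral_swap hi
  convert hswap using 3 with v ω
  · have : (fun ω => {p : unitInterval × Ω | p.1 < Z p.2}.indicator (fun _ => (1 : ℝ)) (v, ω)) =
      {ω | v < Z ω}.indicator 1 := rfl
    rw [this, integral_indicator_one (measurableSet_lt measurable_const hZ)]
  · have : (fun v => {p : unitInterval × Ω | p.1 < Z p.2}.indicator (fun _ => (1 : ℝ)) (v, ω)) =
      (Set.Iio (Z ω)).indicator 1 := rfl
    rw [this, integral_indicator_one measurableSet_Iio, measureReal_restrict_apply
      measurableSet_Iio, Set.inter_comm]

theorem unitInterval_volume_real_Iio (a : unitInterval) : volume.real (Set.Iio a) = a := by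
  rw [measureReal_def, unitInterval.volume_Iio, ENNReal.toReal_ofReal a.2.1]

theorem setIntegral_Iio_measureReal_gt {Ω : Type*} {m : MeasurableSpace Ω} {μ : Measure Ω}
    [IsProbabilityMeasure μ] {Z : Ω → unitInterval} (hZ : Measurable Z) (s : unitInterval) :
    ∫ v in Set.Iio s, μ.real {ω | v < Z ω} = ∫ ω, min (Z ω : ℝ) s ∂μ := by
  rw [setIntegral_measureReal_gt hZ]
  refine integral_congr_ae (Filter.Eventually.of_forall fun ω => ?_)
  simp only [Set.Iio_inter_Iio, unitInterval_volume_real_Iio]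
  rw [inf_comm]
  exact (Subtype.mono_coe _).map_inf _ _

theorem integral_measureReal_gt {Ω : Type*} {m : MeasurableSpace Ω} {μ : Measure Ω}
    [IsProbabilityMeasure μ] {Z : Ω → unitInterval} (hZ : Measurable Z) :
    ∫ v, μ.real {ω | v < Z ω} = ∫ ω, (Z ω : ℝ) ∂μ := by
  simpa [unitInterval_volume_real_Iio] using setIntegral_measureReal_gt (μ := μ) hZ Set.univ

theorem measurable_measureReal_gt {Ω : Type*} {m : MeasurableSpace Ω} (μ : Measure Ω)
    [IsProbabilityMeasure μ] (Z : Ω → unitInterval) :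
    Measurable fun v : unitInterval => μ.real {ω | v < Z ω} :=
  Antitone.measurable fun _ _ hab => measureReal_mono fun _ hω => lt_of_le_of_lt hab hω

theorem measureReal_gt_mem_Icc {Ω : Type*} {m : MeasurableSpace Ω} (μ : Measure Ω)
    [IsProbabilityMeasure μ] (Z : Ω → unitInterval) (v : unitInterval) :
    μ.real {ω | v < Z ω} ∈ Set.Icc (0 : ℝ) 1 :=
  ⟨measureReal_nonneg, measureReal_le_one⟩

/-- If `X ≤ Z` then `Y` is dominated, in the increasing convex order, by the distributional
conjugate `v ↦ ℙ(Z > v)` of `Z`. -/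
theorem integral_hinge_le_conjugate {Ω : Type*} {𝒢 ℋ m : MeasurableSpace Ω}
    {μ : Measure Ω} [IsProbabilityMeasure μ] {A : Set Ω} (hA : MeasurableSet A) (h𝒢 : 𝒢 ≤ m)
    (hℋ : ℋ ≤ m) {X Y : Ω → ℝ} (hX : Measurable X) (hY : Measurable Y)
    (hX01 : ∀ ω, X ω ∈ Set.Icc 0 1) (hY01 : ∀ ω, Y ω ∈ Set.Icc 0 1)
    (h : X =ᵐ[μ] μ[A.indicator (fun _ => (1 : ℝ)) | 𝒢])
    (h' : Y =ᵐ[μ] μ[A.indicator (fun _ => (1 : ℝ)) | ℋ]) (hXY : IndepFun X Y μ)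
    {Z : Ω → unitInterval} (hZ : Measurable Z) (hXZ : ∀ ω, X ω ≤ Z ω) (t : ℝ) :
    ∫ ω, max (Y ω - t) 0 ∂μ ≤ ∫ v : unitInterval, max (μ.real {ω | v < Z ω} - t) 0 := by
  refine (integral_hinge_le_integral_min hA h𝒢 hℋ hX hY hX01 hY01 h h' hXY t).trans ?_
  set s : unitInterval := ⟨μ.real (Y ⁻¹' Set.Ioi t), measureReal_nonneg, measureReal_le_one⟩
  have hG := measurable_measureReal_gt μ Z
  have hGi : Integrable (fun v : unitInterval => μ.real {ω | v < Z ω}) volume :=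
    integrable_of_abs_le hG 1 fun v => by
      rw [abs_of_nonneg measureReal_nonneg]; exact measureReal_le_one
  have hXi : Integrable X μ := integrable_of_abs_le hX 1 fun ω => by
    rw [abs_of_nonneg (hX01 ω).1]; exact (hX01 ω).2
  have hZi : Integrable (fun ω => (Z ω : ℝ)) μ :=
    integrable_of_abs_le (measurable_subtype_coe.comp hZ) 1 fun ω => by
      rw [abs_of_nonneg (Z ω).2.1]; exact (Z ω).2.2
  have hmi : Integrable (fun v : unitInterval => max (μ.real {ω | v < Z ω} - t) 0) volume :=
    (hGi.sub (integrable_const t)).sup (integrable_const 0)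
  calc ∫ ω, min (X ω) s ∂μ - t * s
      ≤ ∫ ω, min (Z ω : ℝ) s ∂μ - t * s := by
        refine sub_le_sub_right (integral_mono (hXi.inf (integrable_const _))
          (hZi.inf (integrable_const _)) fun ω => min_le_min_right _ (hXZ ω)) _
    _ = ∫ v in Set.Iio s, (μ.real {ω | v < Z ω} - t) := by
        rw [← setIntegral_Iio_measureReal_gt hZ, integral_sub hGi.integrableOn
          (integrable_const _), setIntegral_const, unitInterval_volume_real_Iio, smul_eq_mul,
          mul_comm]
    _ ≤ ∫ v in Set.Iio s, max (μ.real {ω | v < Z ω} - t) 0 :=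
        integral_mono (hGi.sub (integrable_const t)).integrableOn hmi.integrableOn
          fun v => le_max_left _ _
    _ ≤ _ := setIntegral_le_integral hmi (Filter.Eventually.of_forall fun v => le_max_right _ _)

/-! ### Replacing the second variable by a conjugate -/

theorem integral_eq_integral_integral_of_indepFun {Ω α β : Type*} {m : MeasurableSpace Ω}
    [MeasurableSpace α] [MeasurableSpace β] {μ : Measure Ω} [IsProbabilityMeasure μ] {X : Ω → α}
    {Y : Ω → β} (hX : Measurable X) (hY : Measurable Y) (hXY : IndepFun X Y μ)
    {F : α × β → ℝ} (hF : Measurable F) {C : ℝ} (hC : ∀ p, |F p| ≤ C) :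
    ∫ ω, F (X ω, Y ω) ∂μ = ∫ ω, ∫ ω', F (X ω, Y ω') ∂μ ∂μ := by
  have := Measure.isProbabilityMeasure_map (μ := μ) hX.aemeasurable
  have := Measure.isProbabilityMeasure_map (μ := μ) hY.aemeasurable
  have hmap := (indepFun_iff_map_prod_eq_prod_map_map hX.aemeasurable hY.aemeasurable).1 hXY
  rw [← integral_map (φ := fun ω => (X ω, Y ω)) (hX.prodMk hY).aemeasurable
    hF.aestronglyMeasurable, hmap, integral_prod _ (integrable_of_abs_le hF C hC),
    integral_map hX.aemeasurable]
  · refine integral_congr_ae (Filter.Eventually.of_forall fun ω => ?_)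
    exact integral_map hY.aemeasurable (Measurable.aestronglyMeasurable (by fun_prop))
  · exact (hF.stronglyMeasurable.integral_prod_right').aestronglyMeasurable

theorem abs_sub_pow_le_one {x y : ℝ} (hx : x ∈ Set.Icc (0 : ℝ) 1) (hy : y ∈ Set.Icc (0 : ℝ) 1)
    (k : ℕ) : |x - y| ^ k ≤ 1 :=
  pow_le_one₀ (abs_nonneg _) (abs_le.2 ⟨by linarith [hx.1, hy.2], by linarith [hx.2, hy.1]⟩)

theorem abs_sub_pow_le_add {x y z ε : ℝ} (hx : x ∈ Set.Icc (0 : ℝ) 1)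
    (hy : y ∈ Set.Icc (0 : ℝ) 1) (hz : z ∈ Set.Icc (0 : ℝ) 1) (h : |x - z| ≤ ε) (k : ℕ) :
    |x - y| ^ k ≤ |z - y| ^ k + k * ε := by
  have h1 := abs_pow_sub_pow_le |x - y| |z - y| k
  rw [abs_abs, abs_abs] at h1
  have e1 : |x - y| ≤ 1 := by simpa using abs_sub_pow_le_one hx hy 1
  have e2 : |z - y| ≤ 1 := by simpa using abs_sub_pow_le_one hz hy 1
  have h2 : |(|x - y| - |z - y|)| ≤ ε := by
    refine (abs_abs_sub_abs_le_abs_sub _ _).trans ?_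
    simpa using h
  have h3 : max |x - y| |z - y| ^ (k - 1) ≤ 1 :=
    pow_le_one₀ (le_max_of_le_left (abs_nonneg _)) (max_le e1 e2)
  have h4 : |(|x - y| - |z - y|)| * k * max |x - y| |z - y| ^ (k - 1) ≤ k * ε := by
    calc _ ≤ |(|x - y| - |z - y|)| * k * 1 := by gcongr
      _ ≤ ε * k * 1 := by gcongr
      _ = k * ε := by ring
  linarith [le_abs_self (|x - y| ^ k - |z - y| ^ k)]

theorem abs_integral_abs_sub_pow_le_one {α : Type*} {m : MeasurableSpace α} (ν : Measure α)
    [IsProbabilityMeasure ν] {V : α → ℝ} (hV : ∀ a, V a ∈ Set.Icc (0 : ℝ) 1) {z : ℝ}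
    (hz : z ∈ Set.Icc (0 : ℝ) 1) (k : ℕ) : |∫ a, |z - V a| ^ k ∂ν| ≤ 1 := by
  have := norm_integral_le_of_norm_le_const (μ := ν) (C := 1)
    (f := fun a => |z - V a| ^ k) (Filter.Eventually.of_forall fun a => by
      rw [Real.norm_eq_abs, abs_of_nonneg (by positivity)]
      exact abs_sub_pow_le_one hz (hV a) _)
  simpa using this

/-- The moment of an independent coherent pair is, up to an error, bounded by that of the pair
formed by an upper approximation `Z` of `X` and an independent copy of its conjugate. -/
theorem integral_abs_sub_pow_le_conjugate {Ω : Type*} {𝒢 ℋ m : MeasurableSpace Ω}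
    {μ : Measure Ω} [IsProbabilityMeasure μ] {A : Set Ω} (hA : MeasurableSet A) (h𝒢 : 𝒢 ≤ m)
    (hℋ : ℋ ≤ m) {X Y : Ω → ℝ} (hX : Measurable X) (hY : Measurable Y)
    (hX01 : ∀ ω, X ω ∈ Set.Icc 0 1) (hY01 : ∀ ω, Y ω ∈ Set.Icc 0 1)
    (h : X =ᵐ[μ] μ[A.indicator (fun _ => (1 : ℝ)) | 𝒢])
    (h' : Y =ᵐ[μ] μ[A.indicator (fun _ => (1 : ℝ)) | ℋ]) (hXY : IndepFun X Y μ)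
    {φ : ℝ → unitInterval} (hφ : Measurable φ) {ε : ℝ} (hφ1 : ∀ x ∈ Set.Icc (0 : ℝ) 1, x ≤ φ x)
    (hφ2 : ∀ x ∈ Set.Icc (0 : ℝ) 1, φ x ≤ x + ε) (j : ℕ) :
    ∫ ω, |X ω - Y ω| ^ (j + 3) ∂μ ≤
      ∫ ω, (∫ v : unitInterval, |(φ (X ω) : ℝ) - μ.real {ω | v < φ (X ω)}| ^ (j + 3)) ∂μ +
        2 * ((j + 3) * ε) := by
  set Z : Ω → unitInterval := fun ω => φ (X ω) with hZdef
  have hZ : Measurable Z := hφ.comp hX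
  have hZ' : Measurable fun ω => (Z ω : ℝ) := measurable_subtype_coe.comp hZ
  have hε : 0 ≤ ε := by
    have := (hφ1 0 (by simp)).trans (hφ2 0 (by simp)); linarith
  have hbound : ∀ {U V : Ω → ℝ}, Measurable U → Measurable V → (∀ ω, U ω ∈ Set.Icc (0 : ℝ) 1) →
      (∀ ω, V ω ∈ Set.Icc (0 : ℝ) 1) → Integrable (fun ω => |U ω - V ω| ^ (j + 3)) μ := by
    intro U V hU hV hU1 hV1
    refine integrable_of_abs_le (by fun_prop) 1 fun ω => ?_
    rw [abs_of_nonneg (by positivity)]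
    exact abs_sub_pow_le_one (hU1 ω) (hV1 ω) _
  have hG := measurable_measureReal_gt μ Z
  have step1 : ∫ ω, |X ω - Y ω| ^ (j + 3) ∂μ ≤
      ∫ ω, |(Z ω : ℝ) - Y ω| ^ (j + 3) ∂μ + (j + 3) * ε := by
    have hi := hbound hZ' hY (fun ω => (Z ω).2) hY01
    have : ∫ ω, |X ω - Y ω| ^ (j + 3) ∂μ ≤
        ∫ ω, (|(Z ω : ℝ) - Y ω| ^ (j + 3) + (j + 3) * ε) ∂μ := by
      refine integral_mono (hbound hX hY hX01 hY01) (hi.add (integrable_const _)) fun ω => ?_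
      have := abs_sub_pow_le_add (ε := ε) (hX01 ω) (hY01 ω) (Z ω).2 (abs_le.2
        ⟨by linarith [hφ2 _ (hX01 ω)], by linarith [hφ1 _ (hX01 ω)]⟩) (j + 3)
      exact_mod_cast this
    rwa [integral_add hi (integrable_const _), integral_const, probReal_univ, one_smul] at this
  have step2 : ∫ ω, |(Z ω : ℝ) - Y ω| ^ (j + 3) ∂μ =
      ∫ ω, ∫ ω', |(Z ω : ℝ) - Y ω'| ^ (j + 3) ∂μ ∂μ := by
    have hind : IndepFun Z Y μ := hXY.comp hφ measurable_id
    -- The integrand must be bounded on the whole product space, not only on the range of `Y`.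
    let clamp : ℝ → ℝ := fun y => max 0 (min 1 y)
    have hcl : ∀ ω, clamp (Y ω) = Y ω := fun ω => by
      simp [clamp, (hY01 ω).1, (hY01 ω).2]
    have := integral_eq_integral_integral_of_indepFun hZ hY hind
      (F := fun p => |(p.1 : ℝ) - clamp p.2| ^ (j + 3)) (by fun_prop) (C := 1) fun p => by
        rw [abs_of_nonneg (by positivity)]
        exact abs_sub_pow_le_one p.1.2 ⟨le_max_left _ _, max_le zero_le_one (min_le_left _ _)⟩ _
    simpa only [hcl] using this
  have hmean : ∫ v : unitInterval, μ.real {ω | v < Z ω} ≤ ∫ ω, Y ω ∂μ + ε := by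
    rw [integral_measureReal_gt hZ, integral_of_ae_eq_condExp hA hℋ h',
      ← integral_of_ae_eq_condExp hA h𝒢 h]
    have hXi : Integrable X μ := integrable_of_abs_le hX 1 fun ω => by
      rw [abs_of_nonneg (hX01 ω).1]; exact (hX01 ω).2
    have hZi : Integrable (fun ω => (Z ω : ℝ)) μ := integrable_of_abs_le hZ' 1 fun ω => by
      rw [abs_of_nonneg (Z ω).2.1]; exact (Z ω).2.2
    have := integral_mono hZi (hXi.add (integrable_const ε)) fun ω => hφ2 _ (hX01 ω)
    simp only [Pi.add_apply] at this
    rwa [integral_add hXi (integrable_const _), integral_const, probReal_univ, one_smul] at this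
  have hm1 : Measurable fun z : ℝ => ∫ ω', |z - Y ω'| ^ (j + 3) ∂μ :=
    (StronglyMeasurable.integral_prod_right (f := fun z ω' => |z - Y ω'| ^ (j + 3))
      (Measurable.stronglyMeasurable (by fun_prop))).measurable
  have hm2 : Measurable fun z : ℝ =>
      ∫ v : unitInterval, |z - μ.real {ω | v < Z ω}| ^ (j + 3) :=
    (StronglyMeasurable.integral_prod_right
      (f := fun z (v : unitInterval) => |z - μ.real {ω | v < Z ω}| ^ (j + 3))
      (Measurable.stronglyMeasurable
        (((measurable_fst.sub (hG.comp measurable_snd)).abs).pow_const _))).measurable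
  have hi2 : Integrable (fun ω =>
      ∫ v : unitInterval, |(Z ω : ℝ) - μ.real {ω | v < Z ω}| ^ (j + 3)) μ :=
    integrable_of_abs_le (hm2.comp hZ') 1 fun ω =>
      abs_integral_abs_sub_pow_le_one volume (measureReal_gt_mem_Icc μ Z) (Z ω).2 _
  -- With the value of `Z` frozen, the hinge comparison applies pointwise in the outer variable.
  have step3 : ∫ ω, ∫ ω', |(Z ω : ℝ) - Y ω'| ^ (j + 3) ∂μ ∂μ ≤
      ∫ ω, ((∫ v : unitInterval, |(Z ω : ℝ) - μ.real {ω | v < Z ω}| ^ (j + 3)) +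
        (j + 3) * ε) ∂μ := by
    refine integral_mono (integrable_of_abs_le (hm1.comp hZ') 1 fun ω =>
      abs_integral_abs_sub_pow_le_one μ hY01 (Z ω).2 _) (hi2.add (integrable_const _)) fun ω => ?_
    exact integral_abs_sub_pow_le_of_hinge hY hG hY01 (measureReal_gt_mem_Icc μ Z) j
      (Z ω).2 hε hmean fun t _ => integral_hinge_le_conjugate hA h𝒢 hℋ hX hY hX01 hY01 h h' hXY
        hZ (fun ω => hφ1 _ (hX01 ω)) t
  rw [integral_add hi2 (integrable_const _), integral_const, probReal_univ, one_smul] at step3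
  linarith

/-! ### Ferrer diagrams and the realising step functions -/

theorem ferrerDiagram_diff_frontier (f : unitInterval → unitInterval) :
    ferrerDiagram f \ frontier (ferrerDiagram f) = interior (ferrerDiagram f) :=
  self_sdiff_frontier _

theorem mem_interior_ferrerDiagram_iff {f : unitInterval → unitInterval} {u v : unitInterval}
    (hu : ∀ᶠ u' in nhds u, f u' = f u) : (u, v) ∈ interior (ferrerDiagram f) ↔ v < f u := by
  refine ⟨fun h => (interior_subset h : (u, v) ∈ ferrerDiagram f), fun h => ?_⟩
  rw [mem_interior_iff_mem_nhds, nhds_prod_eq]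
  filter_upwards [hu.prod_mk (eventually_lt_nhds h)] with p hp
  show p.2 < f p.1
  rw [hp.1]
  exact hp.2

theorem ferrerX_eq {f : unitInterval → unitInterval} {p : unitInterval × unitInterval}
    (hp : ∀ᶠ u in nhds p.1, f u = f p.1) : ferrerX f p = f p.1 := by
  rw [ferrerX, ferrerDiagram_diff_frontier, ← unitInterval_volume_real_Iio]
  simp only [mem_interior_ferrerDiagram_iff hp]
  rfl

theorem ferrerY_eq {f : unitInterval → unitInterval} {G : unitInterval → unitInterval}
    (hf : ∀ᵐ u : unitInterval, ∀ᶠ u' in nhds u, f u' = f u) (hG : ∀ u v, v < f u ↔ u < G v)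
    (p : unitInterval × unitInterval) : ferrerY f p = G p.2 := by
  rw [ferrerY, ferrerDiagram_diff_frontier, ← unitInterval_volume_real_Iio]
  refine measureReal_congr ?_
  filter_upwards [hf] with u hu
  exact propext ((mem_interior_ferrerDiagram_iff hu).trans (hG u p.2))

/-- The step function with steps of height `1 / n` whose conjugate is `v ↦ g ⌊n v⌋`. -/
noncomputable def stairs (n : ℕ) (g : ℕ → ℝ) (u : unitInterval) : unitInterval :=
  ⟨({i ∈ Finset.range n | (u : ℝ) < g i} : Finset ℕ).card / n, by positivity, by
    refine div_le_one_of_le₀ ?_ (Nat.cast_nonneg n)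
    exact_mod_cast (Finset.card_filter_le _ _).trans (Finset.card_range n).le⟩

theorem stairs_mem_STEP (n : ℕ) (g : ℕ → ℝ) : stairs n g ∈ STEP := by
  refine ⟨fun a b hab => ?_, ?_⟩
  · rw [← Subtype.coe_le_coe]
    refine div_le_div_of_nonneg_right ?_ (Nat.cast_nonneg n)
    refine Nat.cast_le.2 (Finset.card_le_card fun i => ?_)
    simp only [Finset.mem_filter]
    exact fun h => ⟨h.1, lt_of_le_of_lt (Subtype.coe_le_coe.2 hab) h.2⟩
  · refine Set.Finite.subset (((Finset.range (n + 1)).finite_toSet.image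
      fun c : ℕ => (c : ℝ) / n).preimage (Subtype.coe_injective.injOn)) ?_
    rintro _ ⟨u, rfl⟩
    refine ⟨_, ?_, rfl⟩
    rw [Finset.mem_coe, Finset.mem_range, Nat.lt_succ_iff]
    exact (Finset.card_filter_le _ _).trans (Finset.card_range n).le

/-- As `g` is antitone, the indices counted by `stairs` form an initial segment, so more than `m`
are counted exactly when `m` is. The case `v = 1` is excluded because its index `n` lies outside the
counted range. -/
theorem lt_stairs_iff {n : ℕ} (hn : 0 < n) {g : ℕ → ℝ} (hg : Antitone g) (u : unitInterval)
    {v : unitInterval} (hv : v < 1) :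
    v < stairs n g u ↔ (u : ℝ) < g ⌊(n : ℝ) * v⌋₊ := by
  have hn' : (0 : ℝ) < n := Nat.cast_pos.2 hn
  have hv' : (v : ℝ) < 1 := hv
  have h0 : 0 ≤ (n : ℝ) * v := mul_nonneg hn'.le v.2.1
  have hlt : ⌊(n : ℝ) * v⌋₊ < n := (Nat.floor_lt h0).2 (by nlinarith)
  rw [← Subtype.coe_lt_coe, stairs, lt_div_iff₀ hn', mul_comm, ← Nat.floor_lt h0]
  set m := ⌊(n : ℝ) * v⌋₊
  constructor
  · intro h
    by_contra hu
    refine absurd h (not_lt.2 ?_)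
    calc _ ≤ (Finset.range m).card := Finset.card_le_card fun i hi => by
          rw [Finset.mem_filter] at hi
          rw [Finset.mem_range]
          by_contra him
          exact hu (hi.2.trans_le (hg (not_lt.1 him)))
      _ = m := Finset.card_range m
  · intro h
    calc m < (Finset.range (m + 1)).card := by simp
      _ ≤ _ := Finset.card_le_card fun i hi => by
          rw [Finset.mem_range] at hi
          rw [Finset.mem_filter, Finset.mem_range]
          exact ⟨by omega, h.trans_le (hg (by omega))⟩

theorem ae_eventually_stairs_eq (n : ℕ) (g : ℕ → ℝ) :
    ∀ᵐ u : unitInterval, ∀ᶠ u' in nhds u, stairs n g u' = stairs n g u := by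
  have hfin : ((fun u : unitInterval => (u : ℝ)) ⁻¹' (g '' (Finset.range n : Set ℕ))).Finite :=
    ((Finset.range n).finite_toSet.image g).preimage Subtype.coe_injective.injOn
  filter_upwards [hfin.countable.ae_notMem volume] with u hu
  have hev : ∀ᶠ u' : unitInterval in nhds u, ∀ i ∈ Finset.range n,
      ((u' : ℝ) < g i ↔ (u : ℝ) < g i) := by
    rw [Filter.eventually_all_finset]
    intro i hi
    have hne : (u : ℝ) ≠ g i := fun h => hu ⟨i, hi, h.symm⟩
    have hcont : Filter.Tendsto (fun u' : unitInterval => (u' : ℝ)) (nhds u) (nhds u) :=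
      continuous_subtype_val.continuousAt
    rcases lt_or_gt_of_ne hne with h | h
    · filter_upwards [hcont.eventually_lt_const h] with u' hu'
      exact iff_of_true hu' h
    · filter_upwards [hcont.eventually_const_lt h] with u' hu'
      exact iff_of_false hu'.not_gt h.not_gt
  filter_upwards [hev] with u' hu'
  have : ({i ∈ Finset.range n | (u' : ℝ) < g i} : Finset ℕ) =
      {i ∈ Finset.range n | (u : ℝ) < g i} := Finset.filter_congr hu'
  simp only [stairs, this]

/-- Rounding up to the next multiple of `1 / n`. -/
noncomputable def roundUp (n : ℕ) (x : ℝ) : unitInterval :=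
  Set.projIcc 0 1 zero_le_one (⌈(n : ℝ) * x⌉₊ / n : ℝ)

theorem measurable_roundUp (n : ℕ) : Measurable (roundUp n) :=
  continuous_projIcc.measurable.comp
    ((measurable_from_nat (f := fun m : ℕ => (m : ℝ) / n)).comp
      (Nat.measurable_ceil.comp (measurable_const_mul _)))

theorem coe_roundUp {n : ℕ} (hn : 0 < n) {x : ℝ} (hx : x ∈ Set.Icc (0 : ℝ) 1) :
    (roundUp n x : ℝ) = ⌈(n : ℝ) * x⌉₊ / n := by
  have h : (⌈(n : ℝ) * x⌉₊ / n : ℝ) ∈ Set.Icc (0 : ℝ) 1 := by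
    refine ⟨by positivity, div_le_one_of_le₀ (Nat.cast_le.2 (Nat.ceil_le.2 ?_)) (by positivity)⟩
    exact mul_le_of_le_one_right (Nat.cast_nonneg n) hx.2
  rw [roundUp, Set.projIcc_of_mem _ h]

theorem le_roundUp {n : ℕ} (hn : 0 < n) {x : ℝ} (hx : x ∈ Set.Icc (0 : ℝ) 1) :
    x ≤ roundUp n x := by
  rw [coe_roundUp hn hx, le_div_iff₀ (Nat.cast_pos.2 hn), mul_comm]
  exact Nat.le_ceil _

theorem roundUp_le_add {n : ℕ} (hn : 0 < n) {x : ℝ} (hx : x ∈ Set.Icc (0 : ℝ) 1) :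
    roundUp n x ≤ x + 1 / n := by
  have hn' : (0 : ℝ) < n := Nat.cast_pos.2 hn
  rw [coe_roundUp hn hx, div_le_iff₀ hn', add_mul, one_div_mul_cancel hn'.ne', mul_comm x]
  exact (Nat.ceil_lt_add_one (mul_nonneg hn'.le hx.1)).le

theorem lt_roundUp_iff {n : ℕ} (hn : 0 < n) {x : ℝ} (hx : x ∈ Set.Icc (0 : ℝ) 1)
    (v : unitInterval) : v < roundUp n x ↔ (⌊(n : ℝ) * v⌋₊ : ℝ) < n * x := by
  have hn' : (0 : ℝ) < n := Nat.cast_pos.2 hn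
  rw [← Subtype.coe_lt_coe, coe_roundUp hn hx, lt_div_iff₀ hn', mul_comm,
    ← Nat.floor_lt (mul_nonneg hn'.le v.2.1), Nat.lt_ceil]

theorem integral_abs_ferrerX_sub_ferrerY {f G : unitInterval → unitInterval} (hfm : Antitone f)
    (hGm : Antitone G) (hf : ∀ᵐ u : unitInterval, ∀ᶠ u' in nhds u, f u' = f u)
    (hG : ∀ u v, v < f u ↔ u < G v) (k : ℕ) :
    ∫ p : unitInterval × unitInterval, |ferrerX f p - ferrerY f p| ^ k =
      ∫ u : unitInterval, ∫ v : unitInterval, |(f u : ℝ) - G v| ^ k := by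
  have h1 : (fun p : unitInterval × unitInterval => |ferrerX f p - ferrerY f p| ^ k) =ᵐ[volume]
      fun p => |(f p.1 : ℝ) - G p.2| ^ k := by
    have h2 : ∀ᵐ p : unitInterval × unitInterval, ∀ᶠ u in nhds p.1, f u = f p.1 :=
      Measure.quasiMeasurePreserving_fst.ae hf
    filter_upwards [h2] with p hp
    rw [ferrerX_eq hp, ferrerY_eq hf hG]
  rw [integral_congr_ae h1, Measure.volume_eq_prod, integral_prod]
  have m1 := hfm.measurable
  have m2 := hGm.measurable
  refine integrable_of_abs_le (by fun_prop) 1 fun p => ?_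
  rw [abs_of_nonneg (by positivity)]
  exact abs_sub_pow_le_one (f p.1).2 (G p.2).2 k

/-- The pair formed by a rounded random variable and its conjugate is realised by a step
function. -/
theorem conjugate_moment_mem_stepMoments {Ω : Type*} {m : MeasurableSpace Ω} {μ : Measure Ω}
    [IsProbabilityMeasure μ] {X : Ω → ℝ} (hX : Measurable X) (hX01 : ∀ ω, X ω ∈ Set.Icc 0 1)
    {n : ℕ} (hn : 0 < n) (k : ℕ) :
    ∫ ω, (∫ v : unitInterval,
      |(roundUp n (X ω) : ℝ) - μ.real {ω | v < roundUp n (X ω)}| ^ k) ∂μ ∈ stepMoments k := by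
  set g : ℕ → ℝ := fun i => μ.real {ω | (i : ℝ) < n * X ω} with hgdef
  have hg : Antitone g := fun a b hab => measureReal_mono fun ω (hω : (b : ℝ) < _) =>
    (lt_of_le_of_lt (Nat.cast_le.2 hab) hω : (a : ℝ) < _)
  set Z : Ω → unitInterval := fun ω => roundUp n (X ω) with hZdef
  have hZ : Measurable Z := (measurable_roundUp n).comp hX
  let G : unitInterval → unitInterval := fun v =>
    ⟨μ.real {ω | v < Z ω}, measureReal_gt_mem_Icc μ Z v⟩
  have hGm : Antitone G := fun a b hab =>
    Subtype.coe_le_coe.1 (measureReal_mono fun _ hω => lt_of_le_of_lt hab hω)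
  have hG : ∀ u v, v < stairs n g u ↔ u < G v := by
    intro u v
    rcases (unitInterval.le_one' (t := v)).lt_or_eq with hv | rfl
    · rw [lt_stairs_iff hn hg u hv, ← Subtype.coe_lt_coe]
      have : {ω | v < Z ω} = {ω | (⌊(n : ℝ) * v⌋₊ : ℝ) < n * X ω} := by
        ext ω; exact lt_roundUp_iff hn (hX01 ω) v
      simp only [G, this, hgdef]
    -- At height `1` both sides fail, as neither `Z` nor `stairs` exceeds `1`.
    · have h0 : G 1 = 0 := by
        have : {ω | (1 : unitInterval) < Z ω} = ∅ := by
          ext ω; simpa using unitInterval.le_one'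
        apply Subtype.ext
        simp [G, this]
      rw [h0]
      exact iff_of_false unitInterval.le_one'.not_gt unitInterval.nonneg'.not_gt
  have hstep := stairs_mem_STEP n g
  -- By the Galois relation `hG`, the set where `stairs` exceeds `v` is `[0, G v)`, of length `ℙ(Z >
  -- v)`.
  have hlaw : (volume : Measure unitInterval).map (stairs n g) = μ.map Z := by
    have := Measure.isProbabilityMeasure_map (μ := (volume : Measure unitInterval))
      hstep.1.measurable.aemeasurable
    have := Measure.isProbabilityMeasure_map (μ := μ) hZ.aemeasurable
    refine Measure.ext_of_Iic _ _ fun v => ?_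
    rw [← Set.compl_Ioi, prob_compl_eq_one_sub measurableSet_Ioi,
      prob_compl_eq_one_sub measurableSet_Ioi,
      Measure.map_apply hstep.1.measurable measurableSet_Ioi,
      Measure.map_apply hZ measurableSet_Ioi]
    congr 1
    have : stairs n g ⁻¹' Set.Ioi v = Set.Iio (G v) := by ext u; exact hG u v
    rw [this, unitInterval.volume_Iio, ofReal_measureReal]
    rfl
  refine ⟨stairs n g, hstep, ?_⟩
  rw [integral_abs_ferrerX_sub_ferrerY hstep.1 hGm (ae_eventually_stairs_eq n g) hG]
  have hm : StronglyMeasurable fun z : unitInterval =>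
      ∫ v : unitInterval, |(z : ℝ) - G v| ^ k := by
    have := hGm.measurable
    exact StronglyMeasurable.integral_prod_right
      (f := fun (z v : unitInterval) => |(z : ℝ) - G v| ^ k)
      (Measurable.stronglyMeasurable (by fun_prop))
  rw [← integral_map (f := fun z : unitInterval => ∫ v : unitInterval, |(z : ℝ) - G v| ^ k)
    hstep.1.measurable.aemeasurable hm.aestronglyMeasurable, hlaw,
    integral_map hZ.aemeasurable hm.aestronglyMeasurable]

/-! ### Step functions as coherent pairs -/

/-- Fubini's theorem: integrating section lengths over `S` gives the measure of the part of `D`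
above `S`. Swapping `U` and `V` and transposing `D` covers the other coordinate. -/
theorem section_ae_eq_condExp {Ω : Type*} {m : MeasurableSpace Ω} {μ : Measure Ω}
    [IsProbabilityMeasure μ] {U V : Ω → unitInterval} (hU : Measurable U) (hV : Measurable V)
    (hUV : μ.map (fun ω => (U ω, V ω)) = volume) {D : Set (unitInterval × unitInterval)}
    (hD : MeasurableSet D) :
    (fun ω => volume.real {v | (U ω, v) ∈ D}) =ᵐ[μ]
      μ[((fun ω => (U ω, V ω)) ⁻¹' D).indicator (fun _ => (1 : ℝ)) |
        MeasurableSpace.comap U inferInstance] := by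
  have hφ : Measurable fun u => volume.real {v | (u, v) ∈ D} :=
    (measurable_measure_prodMk_left hD).ennreal_toReal
  have hUm : Measurable[MeasurableSpace.comap U inferInstance] U := comap_measurable U
  have hA : MeasurableSet ((fun ω => (U ω, V ω)) ⁻¹' D) := (hU.prodMk hV) hD
  refine ae_eq_condExp_of_forall_setIntegral_eq hU.comap_le
    ((integrable_const (1 : ℝ)).indicator hA) (fun s _ _ => ?_) ?_ ?_
  · exact (integrable_of_abs_le (hφ.comp hU) 1 fun ω => by
      rw [Function.comp_apply, abs_of_nonneg measureReal_nonneg]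
      exact measureReal_le_one).integrableOn
  · rintro _ ⟨S, hS, rfl⟩ -
    rw [integral_indicator hA, Measure.restrict_restrict hA, setIntegral_const, smul_eq_mul,
      mul_one]
    have hUmap : μ.map U = volume := by
      have : U = Prod.fst ∘ fun ω => (U ω, V ω) := rfl
      rw [this, ← Measure.map_map measurable_fst (hU.prodMk hV), hUV, Measure.volume_eq_prod,
        Measure.map_fst_prod]
      simp
    have hE : MeasurableSet (D ∩ Prod.fst ⁻¹' S) := hD.inter (measurable_fst hS)
    have h1 : μ.real ((fun ω => (U ω, V ω)) ⁻¹' D ∩ U ⁻¹' S) =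
        volume.real (D ∩ Prod.fst ⁻¹' S) := by
      rw [← hUV, map_measureReal_apply (hU.prodMk hV) hE]
      rfl
    have h2 : ∫ ω in U ⁻¹' S, volume.real {v | (U ω, v) ∈ D} ∂μ =
        ∫ u in S, volume.real {v | (u, v) ∈ D} := by
      have h3 := setIntegral_map (μ := μ) hS hφ.aestronglyMeasurable hU.aemeasurable
      rw [hUmap] at h3
      exact h3.symm
    rw [h1, h2, measureReal_def, Measure.volume_eq_prod, Measure.prod_apply hE,
      ← integral_indicator hS, ← integral_toReal]
    · refine integral_congr_ae (Filter.Eventually.of_forall fun u => ?_)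
      by_cases hu : u ∈ S
      · simp only [Set.indicator_of_mem hu, measureReal_def]
        congr 2
        ext v; simp [hu]
      · simp only [Set.indicator_of_notMem hu]
        have : Prod.mk u ⁻¹' (D ∩ Prod.fst ⁻¹' S) = ∅ := by ext v; simp [hu]
        rw [this]; simp
    · exact (measurable_measure_prodMk_left hE).aemeasurable
    · exact Filter.Eventually.of_forall fun u => measure_lt_top _ _
  · exact (hφ.comp hUm).stronglyMeasurable.aestronglyMeasurable

theorem stepMoments_subset_indepCoherentMoments (k : ℕ) :
    stepMoments k ⊆ indepCoherentMoments.{u} k := by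
  rintro r ⟨f, -, rfl⟩
  -- The square lives in the lowest universe and is lifted to the one in which the coherent pairs
  -- are taken.
  let μ : Measure (ULift.{u} (unitInterval × unitInterval)) := volume.map ULift.up
  have hup : Measurable (ULift.up.{u} : unitInterval × unitInterval → _) := measurable_up
  have hdn : Measurable (ULift.down.{u} : _ → unitInterval × unitInterval) := measurable_down
  have hμ : IsProbabilityMeasure μ := Measure.isProbabilityMeasure_map hup.aemeasurable
  have hmap : μ.map ULift.down = volume := by
    rw [Measure.map_map hdn hup]
    exact Measure.map_id
  let U : ULift.{u} (unitInterval × unitInterval) → unitInterval := fun ω => ω.down.1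
  let V : ULift.{u} (unitInterval × unitInterval) → unitInterval := fun ω => ω.down.2
  have hU : Measurable U := measurable_fst.comp hdn
  have hV : Measurable V := measurable_snd.comp hdn
  have hUV : μ.map (fun ω => (U ω, V ω)) = volume := hmap
  have hVU : μ.map (fun ω => (V ω, U ω)) = volume := by
    have : (fun ω => (V ω, U ω)) = Prod.swap ∘ fun ω => (U ω, V ω) := rfl
    rw [this, ← Measure.map_map measurable_swap (hU.prodMk hV), hUV, Measure.volume_eq_prod,
      Measure.prod_swap]
  have hind : IndepFun U V μ := by
    rw [indepFun_iff_map_prod_eq_prod_map_map hU.aemeasurable hV.aemeasurable, hUV]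
    have e1 : μ.map U = volume := by
      have : U = Prod.fst ∘ fun ω => (U ω, V ω) := rfl
      rw [this, ← Measure.map_map measurable_fst (hU.prodMk hV), hUV, Measure.volume_eq_prod,
        Measure.map_fst_prod]
      simp
    have e2 : μ.map V = volume := by
      have : V = Prod.fst ∘ fun ω => (V ω, U ω) := rfl
      rw [this, ← Measure.map_map measurable_fst (hV.prodMk hU), hVU, Measure.volume_eq_prod,
        Measure.map_fst_prod]
      simp
    rw [e1, e2, Measure.volume_eq_prod]
  set D := ferrerDiagram f \ frontier (ferrerDiagram f) with hDdef
  have hD : MeasurableSet D := by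
    rw [hDdef, self_sdiff_frontier]
    exact isOpen_interior.measurableSet
  have hD' : MeasurableSet (Prod.swap ⁻¹' D) := measurable_swap hD
  have hφ : Measurable fun u => volume.real {v | (u, v) ∈ D} :=
    (measurable_measure_prodMk_left hD).ennreal_toReal
  have hψ : Measurable fun v => volume.real {u | (u, v) ∈ D} :=
    (measurable_measure_prodMk_left hD').ennreal_toReal
  have hX : Measurable fun ω : ULift.{u} (unitInterval × unitInterval) => ferrerX f ω.down :=
    hφ.comp hU
  have hY : Measurable fun ω : ULift.{u} (unitInterval × unitInterval) => ferrerY f ω.down :=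
    hψ.comp hV
  refine ⟨_, inferInstance, μ, hμ, fun ω => ferrerX f ω.down, fun ω => ferrerY f ω.down,
    ⟨⟨hX, hY, ULift.down ⁻¹' D, _, _, hdn hD, hU.comap_le, hV.comap_le,
      section_ae_eq_condExp hU hV hUV hD, section_ae_eq_condExp hV hU hVU hD'⟩,
      hind.comp hφ hψ⟩, ?_⟩
  rw [← hmap, integral_map hdn.aemeasurable]
  have hX' : Measurable (ferrerX f) := hφ.comp measurable_fst
  have hY' : Measurable (ferrerY f) := hψ.comp measurable_snd
  exact Measurable.aestronglyMeasurable (by fun_prop)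

theorem stepMoments_le_one {k : ℕ} {r : ℝ} (hr : r ∈ stepMoments k) : r ≤ 1 := by
  obtain ⟨f, -, rfl⟩ := hr
  have h01 : ∀ S : Set unitInterval, volume.real S ∈ Set.Icc (0 : ℝ) 1 :=
    fun S => ⟨measureReal_nonneg, measureReal_le_one⟩
  have := norm_integral_le_of_norm_le_const (C := 1)
    (μ := (volume : Measure (unitInterval × unitInterval)))
    (f := fun p => |ferrerX f p - ferrerY f p| ^ k) (Filter.Eventually.of_forall fun p => by
      rw [Real.norm_eq_abs, abs_of_nonneg (by positivity)]
      exact abs_sub_pow_le_one (h01 _) (h01 _) k)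
  exact (le_abs_self _).trans (by simpa using this)

/-! ### Passage to the limit and conclusion -/

theorem ae_mem_Icc_of_ae_eq_condExp {Ω : Type*} {𝒢 m : MeasurableSpace Ω}
    {μ : Measure Ω} [IsProbabilityMeasure μ] {A : Set Ω} (hA : MeasurableSet A)
    (h𝒢 : 𝒢 ≤ m) {X : Ω → ℝ} (h : X =ᵐ[μ] μ[A.indicator (fun _ => (1 : ℝ)) | 𝒢]) :
    ∀ᵐ ω ∂μ, X ω ∈ Set.Icc (0 : ℝ) 1 := by
  have hi : Integrable (A.indicator fun _ => (1 : ℝ)) μ := (integrable_const _).indicator hA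
  have h0 : 0 ≤ᵐ[μ] μ[A.indicator (fun _ => (1 : ℝ)) | 𝒢] :=
    condExp_nonneg (Filter.Eventually.of_forall fun ω =>
      Set.indicator_nonneg (fun _ _ => zero_le_one) ω)
  have h1 : μ[A.indicator (fun _ => (1 : ℝ)) | 𝒢] ≤ᵐ[μ] μ[fun _ => (1 : ℝ) | 𝒢] :=
    condExp_mono hi (integrable_const _) (Filter.Eventually.of_forall fun ω =>
      Set.indicator_le_self' (fun _ _ => zero_le_one) ω)
  rw [condExp_const h𝒢] at h1
  filter_upwards [h, h0, h1] with ω e e0 e1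
  rw [e]
  exact ⟨e0, e1⟩

/-- Every upper bound for the moments of step functions bounds those of independent coherent
pairs. -/
theorem indepCoherentMoments_le {j : ℕ} {s : ℝ} (hs : s ∈ upperBounds (stepMoments (j + 3)))
    {r : ℝ} (hr : r ∈ indepCoherentMoments.{u} (j + 3)) : r ≤ s := by
  obtain ⟨Ω, m, μ, hμ, X, Y, ⟨⟨hX, hY, A, 𝒢, ℋ, hA, h𝒢, hℋ, hXA, hYA⟩, hXY⟩, rfl⟩ := hr
  -- Conditional probabilities lie in `[0, 1]` only almost surely; clamping makes this hold
  -- everywhere and preserves coherence, independence and the moment.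
  let clamp : ℝ → ℝ := fun x => max 0 (min 1 x)
  have hcl : Measurable clamp := by fun_prop
  have hcl01 : ∀ x, clamp x ∈ Set.Icc (0 : ℝ) 1 := fun x =>
    ⟨le_max_left _ _, max_le zero_le_one (min_le_left _ _)⟩
  have hfix : ∀ x ∈ Set.Icc (0 : ℝ) 1, clamp x = x := fun x hx => by simp [clamp, hx.1, hx.2]
  have hXe : clamp ∘ X =ᵐ[μ] X := (ae_mem_Icc_of_ae_eq_condExp hA h𝒢 hXA).mono fun ω => hfix _
  have hYe : clamp ∘ Y =ᵐ[μ] Y := (ae_mem_Icc_of_ae_eq_condExp hA hℋ hYA).mono fun ω => hfix _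
  have hmom : ∫ ω, |X ω - Y ω| ^ (j + 3) ∂μ =
      ∫ ω, |(clamp ∘ X) ω - (clamp ∘ Y) ω| ^ (j + 3) ∂μ := by
    refine integral_congr_ae ?_
    filter_upwards [hXe, hYe] with ω e1 e2
    rw [e1, e2]
  have hbound : ∀ n : ℕ, ∫ ω, |X ω - Y ω| ^ (j + 3) ∂μ ≤
      s + 2 * ((j + 3) * (1 / ((n : ℝ) + 1))) := by
    intro n
    rw [hmom]
    have h1 := integral_abs_sub_pow_le_conjugate hA h𝒢 hℋ (hcl.comp hX) (hcl.comp hY)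
      (fun ω => hcl01 _) (fun ω => hcl01 _) (hXe.trans hXA) (hYe.trans hYA) (hXY.comp hcl hcl)
      (measurable_roundUp (n + 1)) (fun x hx => le_roundUp n.succ_pos hx)
      (fun x hx => roundUp_le_add n.succ_pos hx) j
    have h2 := hs (conjugate_moment_mem_stepMoments (μ := μ) (hcl.comp hX) (fun ω => hcl01 _)
      n.succ_pos (j + 3))
    push_cast at h1
    linarith
  have hlim : Filter.Tendsto (fun n : ℕ => s + 2 * (((j : ℝ) + 3) * (1 / ((n : ℝ) + 1))))
      Filter.atTop (nhds s) := by
    simpa using ((tendsto_one_div_add_atTop_nhds_zero_nat.const_mul ((j : ℝ) + 3)).const_mul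
      2).const_add s
  exact ge_of_tendsto' hlim hbound

theorem mainTheorem6 (k : ℕ) (hk : 3 ≤ k) :
    ∃ s : ℝ, IsLUB (stepMoments k) s ∧ IsLUB (indepCoherentMoments.{u} k) s := by
  obtain ⟨j, rfl⟩ := Nat.exists_eq_add_of_le' hk
  -- `stairs 0 0` is the zero function, since its value `0 / 0` is `0`.
  have hne : (stepMoments (j + 3)).Nonempty := ⟨_, _, stairs_mem_STEP 0 0, rfl⟩
  have hlub := isLUB_csSup hne ⟨1, fun r hr => stepMoments_le_one hr⟩
  exact ⟨_, hlub, fun r hr => indepCoherentMoments_le hlub.1 hr,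
    fun b hb => hlub.2 fun r hr => hb (stepMoments_subset_indepCoherentMoments _ hr)⟩
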